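/- Let $n,d\ge 1$ be integers, $p\in[1,\infty)$, $\varepsilon>0$, let $\mathcal D\subseteq\mathbb R^{n\times d}$ be compact and $f:\mathcal D\to\mathbb R^{n\times d}$ continuous. Write $\mathbf 1$ for the all-one vector in $\mathbb R^n$ and $\mathrm{softmax}$ for the row-wise softmax of a matrix. For each head $h\in\{1,2\}$ let $A^h$ be a parametrized attention map, that is, a family of maps $A^h_\theta:\mathbb R^{n\times d}\to\mathbb R^{n\times n}$ indexed by parameters $\theta\in\Theta^h$. A Transformer block (with $2$ heads of dimension $1$, $4$ hidden units, skip connections, biases and no normalization) is a map $\mathrm{FFN}\circ\mathrm{Attn}$ with $$\mathrm{Attn}(X)=X+\sum_{h=1}^{2}\Big(A^h_{\theta_h}(X)\big(XW_V^h+c_V^h\mathbf 1\big)W_O^h+\mathbf 1 (c_O^{h})^{\top}\Big),$$ $$\mathrm{FFN}(X)=X+\mathrm{ReLU}\big(XW_1+\mathbf 1 b_1^\top\big)W_2+\mathbf 1 b_2^\top,$$ where $\theta_h\in\Theta^h$, $W_V^h\in\mathbb R^{d\times 1}$, $c_V^h\in\mathbb R$, $W_O^h\in\mathbb R^{1\times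 d}$, $c_O^h\in\mathbb R^{d}$, $W_1\in\mathbb R^{d\times 4}$, $b_1\in\mathbb R^4$, $W_2\in\mathbb R^{4\times d}$, $b_2\in\mathbb R^d$ are arbitrary. Let $\Omega_{\mathrm U}^{2,1,4}$ be the set of all compositions $g_L\circ\cdots\circ g_1:\mathbb R^{n\times d}\to\mathbb R^{n\times d}$ of $L\ge1$ such blocks. Assume that for each $h$: - (Attentive condition) for every $u\in\mathbb R^{d\times1}$ and $c\in\mathbb R$ there is $\theta\in\Theta^h$ such that $A^h_\theta(X)=\mathrm{softmax}\big(Xu\,(Xu-c\mathbf 1)^\top\big)$ for all $X\in\mathbb R^{n\times d}$; - (Position-aware condition) there are $\theta\in\Theta^h$ and a vector $v\in\mathbb R^n$ with pairwise distinct entries such that $A^h_\theta(X)\mathbf 1=v$ for all $X\in\mathbb R^{n\times d}$. Then there is $g\in\Omega_{\mathrm U}^{2,1,4}$ such that $X\mapsto\|f(X)-g(X)\|_p^p$ is Lebesgue integrable on $\mathcal D$ and $$\Big(\int_{\mathcal D}\|f(X)-g(X)\|_p^p\,dX\Big)^{1/p}<\varepsilon,$$ where $\|\cdot\|_p$ is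 the entrywise $\ell^p$ norm of a matrix. -/

import Mathlib

open Matrix MeasureTheory

noncomputable section

/-- Entrywise rectified linear unit. -/
def relu {m k : ℕ} (M : Matrix (Fin m) (Fin k) ℝ) : Matrix (Fin m) (Fin k) ℝ :=
  M.map fun t => max t 0

/-- Row-wise softmax of a square matrix; the value is a right stochastic matrix. -/
def rowSoftmax {n : ℕ} (M : Matrix (Fin n) (Fin n) ℝ) : Matrix (Fin n) (Fin n) ℝ :=
  Matrix.of fun i j => Real.exp (M i j) / ∑ k, Real.exp (M i k)

/-- Entrywise `ℓ^p` norm of a real matrix. -/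
def entryNorm {m k : ℕ} (p : ℝ) (M : Matrix (Fin m) (Fin k) ℝ) : ℝ :=
  (∑ i, ∑ j, |M i j| ^ p) ^ (1 / p)

/-- The affine map `X ↦ X W + 1 bᵀ` applied to every row of `X`. -/
def affineRows {n k l : ℕ} (W : Matrix (Fin k) (Fin l) ℝ) (b : Fin l → ℝ)
    (X : Matrix (Fin n) (Fin k) ℝ) : Matrix (Fin n) (Fin l) ℝ :=
  X * W + vecMulVec (fun _ => 1) b

/-- Learnable parameters of one attention head, apart from those of its attention matrix:
value and output projections, each with its bias. -/
structure HeadParams (d dH : ℕ) where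
  WV : Matrix (Fin d) (Fin dH) ℝ
  cV : Fin dH → ℝ
  WO : Matrix (Fin dH) (Fin d) ℝ
  cO : Fin d → ℝ

/-- Learnable parameters of a feed-forward layer with `r` hidden units. -/
structure FFNParams (d r : ℕ) where
  W₁ : Matrix (Fin d) (Fin r) ℝ
  b₁ : Fin r → ℝ
  W₂ : Matrix (Fin r) (Fin d) ℝ
  b₂ : Fin d → ℝ

/-- Multi-head attention layer with skip connection,
`X + ∑ h, (A h X (X W_V^h + 1 (c_V^h)ᵀ) W_O^h + 1 (c_O^h)ᵀ)`, for given maps `A h` from the input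
to attention matrices. -/
def attnLayer {n d dH H : ℕ} (A : Fin H → Matrix (Fin n) (Fin d) ℝ → Matrix (Fin n) (Fin n) ℝ)
    (P : Fin H → HeadParams d dH) (X : Matrix (Fin n) (Fin d) ℝ) : Matrix (Fin n) (Fin d) ℝ :=
  X + ∑ h, affineRows (P h).WO (P h).cO (A h X * affineRows (P h).WV (P h).cV X)

/-- Feed-forward layer with skip connection, `X + (ReLU (X W₁ + 1 b₁ᵀ) W₂ + 1 b₂ᵀ)`. -/
def ffnLayer {n d r : ℕ} (Q : FFNParams d r) (X : Matrix (Fin n) (Fin d) ℝ) :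
    Matrix (Fin n) (Fin d) ℝ :=
  X + affineRows Q.W₂ Q.b₂ (relu (affineRows Q.W₁ Q.b₁ X))

/-- The class of Transformer blocks with `H` heads of dimension `dH` and `r` hidden units. The
attention of head `h` has the parametric form `A h`, with parameters ranging over `Θ h`; the
parameters of distinct heads are chosen independently. -/
def transformerBlocks {n d H : ℕ} {Θ : Fin H → Type*}
    (A : (h : Fin H) → Θ h → Matrix (Fin n) (Fin d) ℝ → Matrix (Fin n) (Fin n) ℝ)
    (dH r : ℕ) : Set (Matrix (Fin n) (Fin d) ℝ → Matrix (Fin n) (Fin d) ℝ) :=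
  {g | ∃ (θ : (h : Fin H) → Θ h) (P : Fin H → HeadParams d dH) (Q : FFNParams d r),
    g = fun X => ffnLayer Q (attnLayer (fun h => A h (θ h)) P X)}

/-- The class of Transformers: compositions `g_L ∘ ⋯ ∘ g_1` of `L ≥ 1` Transformer blocks
(the list is `[g_L, …, g_1]`). -/
def transformers {n d H : ℕ} {Θ : Fin H → Type*}
    (A : (h : Fin H) → Θ h → Matrix (Fin n) (Fin d) ℝ → Matrix (Fin n) (Fin n) ℝ)
    (dH r : ℕ) : Set (Matrix (Fin n) (Fin d) ℝ → Matrix (Fin n) (Fin d) ℝ) :=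
  {g | ∃ l : List (Matrix (Fin n) (Fin d) ℝ → Matrix (Fin n) (Fin d) ℝ),
    l ≠ [] ∧ (∀ b ∈ l, b ∈ transformerBlocks A dH r) ∧ g = l.foldr (fun b k => b ∘ k) id}

/-- Attentive condition: for all `u` and `c`, some parameter value realises
`X ↦ softmax (X u (X u - c 1)ᵀ)`. -/
def Attentive {n d : ℕ} {Θ : Type*}
    (A : Θ → Matrix (Fin n) (Fin d) ℝ → Matrix (Fin n) (Fin n) ℝ) : Prop :=
  ∀ (u : Fin d → ℝ) (c : ℝ), ∃ θ : Θ, ∀ X : Matrix (Fin n) (Fin d) ℝ,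
    A θ X = rowSoftmax (vecMulVec (X *ᵥ u) (X *ᵥ u - fun _ => c))

/-- Position-aware condition: some parameter value satisfies `A(X) 1 = v` for all inputs `X`,
where `v` has pairwise distinct entries. -/
def PositionAware {n d : ℕ} {Θ : Type*}
    (A : Θ → Matrix (Fin n) (Fin d) ℝ → Matrix (Fin n) (Fin n) ℝ) : Prop :=
  ∃ (θ : Θ) (v : Fin n → ℝ), Function.Injective v ∧
    ∀ X : Matrix (Fin n) (Fin d) ℝ, A θ X *ᵥ (fun _ => 1) = v

end

noncomputable section

/-! Feed-forward blocks collapse grid cells of side `δ` onto corners, except for thin gaps of width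
`η`, so most inputs land on a finite set of matrices (`exists_quantize`). It then suffices to
interpolate exactly on that finite set (`exists_transformer_eqOn`). For the interpolation, the
position-aware head adds a multiple of `v`, so that a token reveals its position. Row-wise maps then
turn tokens into positive integers `t j`. Softmax attention at row `i` returns their mean with
weights `z ^ t j`, where `z = exp (s² t i)`. This mean is the logarithmic derivative, times `z`, of
`P = ∑ X ^ t j`, and `P` is recovered from that derivative and `P 1 = n`. So for generic `s` the
mean tells different inputs apart, and a final row-wise map sends each contextual token to its
target. As `η → 0`, every fixed input eventually leaves the gaps. Clipping the output gives a
uniform bound, and dominated convergence makes the error small. Continuity is carried along because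
it makes the error integrable, while an arbitrary `A` need not be continuous. -/

/-- Continuous Transformers with two heads of dimension one and four hidden units. -/
def continuousTransformers {n d : ℕ} {Θ : Fin 2 → Type*}
    (A : (h : Fin 2) → Θ h → Matrix (Fin n) (Fin d) ℝ → Matrix (Fin n) (Fin n) ℝ) :
    Set (Matrix (Fin n) (Fin d) ℝ → Matrix (Fin n) (Fin d) ℝ) :=
  {g | g ∈ transformers A 1 4 ∧ Continuous g}

/-! ### Elementary Transformer blocks -/

section Blocks

variable {n d : ℕ} {Θ : Fin 2 → Type*}
  {A : (h : Fin 2) → Θ h → Matrix (Fin n) (Fin d) ℝ → Matrix (Fin n) (Fin n) ℝ}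

theorem comp_mem_transformers {g₁ g₂ : Matrix (Fin n) (Fin d) ℝ → Matrix (Fin n) (Fin d) ℝ}
    (h₁ : g₁ ∈ transformers A 1 4) (h₂ : g₂ ∈ transformers A 1 4) :
    g₁ ∘ g₂ ∈ transformers A 1 4 := by
  obtain ⟨l₁, hl₁, hb₁, rfl⟩ := h₁
  obtain ⟨l₂, -, hb₂, rfl⟩ := h₂
  refine ⟨l₁ ++ l₂, by simp [hl₁], fun b hb => ?_, ?_⟩
  · rcases List.mem_append.1 hb with hb | hb
    exacts [hb₁ b hb, hb₂ b hb]
  · clear hl₁ hb₁ hb₂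
    induction l₁ with
    | nil => rfl
    | cons a l ih => simp only [List.cons_append, List.foldr_cons, ← ih, Function.comp_assoc]

theorem comp_mem_continuousTransformers
    {g₁ g₂ : Matrix (Fin n) (Fin d) ℝ → Matrix (Fin n) (Fin d) ℝ}
    (h₁ : g₁ ∈ continuousTransformers A) (h₂ : g₂ ∈ continuousTransformers A) :
    g₁ ∘ g₂ ∈ continuousTransformers A :=
  ⟨comp_mem_transformers h₁.1 h₂.1, h₁.2.comp h₂.2⟩

theorem block_mem_transformers {g : Matrix (Fin n) (Fin d) ℝ → Matrix (Fin n) (Fin d) ℝ}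
    (hg : g ∈ transformerBlocks A 1 4) : g ∈ transformers A 1 4 :=
  ⟨[g], by simp, by simpa using hg, rfl⟩

/-- An attention head of the given type with output projected onto the first coordinate, followed
by a trivial feed-forward layer. -/
theorem attention_mem_transformers (θ : (h : Fin 2) → Θ h) (w : Fin d → ℝ) (a : Fin d → ℝ)
    (c : ℝ) :
    (fun X => X + vecMulVec (A 0 (θ 0) X *ᵥ (fun j => (X *ᵥ a) j + c)) w)
      ∈ transformers A 1 4 := by
  refine block_mem_transformers ⟨θ, ![⟨Matrix.of fun j _ => a j, fun _ => c,
    Matrix.of fun _ j => w j, 0⟩, ⟨0, 0, 0, 0⟩], ⟨0, 0, 0, 0⟩, ?_⟩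
  funext X
  ext i j
  simp [ffnLayer, attnLayer, affineRows, vecMulVec_apply, Matrix.mul_apply, mulVec, dotProduct,
    Matrix.add_apply]

/-- A row-wise shift in direction `w` by a one-dimensional function of `u ⬝ᵥ x`. -/
def ridge (a σ b : Fin 4 → ℝ) (u w c : Fin d → ℝ) (x : Fin d → ℝ) : Fin d → ℝ :=
  x + (∑ k, a k * max (σ k * (u ⬝ᵥ x) + b k) 0) • w + c

/-- Row-wise application of a map. -/
def mapRows (g : (Fin d → ℝ) → (Fin d → ℝ)) (X : Matrix (Fin n) (Fin d) ℝ) :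
    Matrix (Fin n) (Fin d) ℝ :=
  Matrix.of fun i => g (X i)

theorem mapRows_ridge_mem [h : Nonempty ((h : Fin 2) → Θ h)] (a σ b : Fin 4 → ℝ)
    (u w c : Fin d → ℝ) :
    mapRows (ridge a σ b u w c) ∈ continuousTransformers A := by
  obtain ⟨θ⟩ := h
  constructor
  · refine block_mem_transformers ⟨θ, fun _ => ⟨0, 0, 0, 0⟩,
      ⟨vecMulVec u σ, b, vecMulVec a w, c⟩, ?_⟩
    funext X
    have hattn : attnLayer (fun h => A h (θ h)) (fun _ => (⟨0, 0, 0, 0⟩ : HeadParams d 1)) X = X := by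
      ext i j
      simp [attnLayer, affineRows, vecMulVec_apply]
    rw [hattn]
    ext i j
    simp only [mapRows, ridge, ffnLayer, affineRows, relu, vecMulVec_apply, Matrix.mul_apply,
      dotProduct, Matrix.add_apply, Matrix.of_apply, Pi.add_apply, Pi.smul_apply, smul_eq_mul,
      Matrix.map_apply, Finset.sum_mul, one_mul]
    rw [add_assoc]
    refine congrArg₂ (· + ·) rfl (congrArg₂ (· + ·) (Finset.sum_congr rfl fun k _ => ?_) rfl)
    have : σ k * ∑ x, u x * X i x = ∑ x, X i x * (u x * σ k) := by
      rw [Finset.mul_sum]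
      exact Finset.sum_congr rfl fun x _ => by ring
    rw [this]
    ring
  · refine continuous_matrix fun i j => ?_
    simp only [mapRows, ridge, dotProduct, Matrix.of_apply, Pi.add_apply, Pi.smul_apply,
      smul_eq_mul]
    have h (x : Fin d) : Continuous fun X : Matrix (Fin n) (Fin d) ℝ => X i x :=
      continuous_id.matrix_elem i x
    fun_prop

/-- A tent of height one moves a single point. -/
theorem exists_mapRows_move [Nonempty ((h : Fin 2) → Θ h)] (u w : Fin d → ℝ) (τ : ℝ) {r : ℝ}
    (hr : 0 < r) :
    ∃ g, mapRows g ∈ continuousTransformers A ∧ (∀ x, u ⬝ᵥ x = τ → g x = x + w) ∧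
      ∀ x, r ≤ |u ⬝ᵥ x - τ| → g x = x := by
  -- Three ReLUs form the tent with apex `τ` and half-width `r`; the fourth is idle.
  refine ⟨_, mapRows_ridge_mem ![1 / r, -2 / r, 1 / r, 0] ![1, 1, 1, 1]
    ![-τ + r, -τ, -τ - r, 0] u w 0, fun x hx => ?_, fun x hx => ?_⟩
  · have h2 : max (τ + (-τ - r)) 0 = 0 := by rw [max_eq_right]; linarith
    simp only [ridge, hx, Fin.sum_univ_four]
    simp [h2, max_eq_left hr.le, hr.ne']
  · simp only [ridge, Fin.sum_univ_four]
    generalize u ⬝ᵥ x = t at hx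
    simp only [cons_val_zero, cons_val_one, cons_val, one_mul, zero_mul, add_zero]
    convert add_zero x using 2
    convert zero_smul ℝ w using 2
    rcases le_abs.1 hx with h | h
    · rw [max_eq_left, max_eq_left, max_eq_left] <;> first | linarith | skip
      field_simp
      ring
    · rw [max_eq_right, max_eq_right, max_eq_right] <;> linarith

theorem id_mem_continuousTransformers [Nonempty ((h : Fin 2) → Θ h)] :
    (fun X => X) ∈ continuousTransformers A := by
  have := mapRows_ridge_mem (A := A) 0 0 0 0 0 0
  convert this using 1
  funext X
  ext i j
  simp [mapRows, ridge]

end Blocks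

/-! ### Boltzmann means separate sets of exponents -/

section Boltzmann

open Polynomial in
/-- Two polynomials with the same logarithmic derivative agree, if they agree and do not vanish
at `1`. -/
theorem Polynomial.eq_of_derivative_mul_eq {p q : ℝ[X]} (hpq : p.eval 1 = q.eval 1)
    (hq : q.eval 1 ≠ 0) (h : derivative p * q = derivative q * p) : p = q := by
  by_contra hne
  have hr : p - q ≠ 0 := sub_ne_zero.2 hne
  -- Compare orders of vanishing at `1` in `(p - q)' q = q' (p - q)`: differentiation lowers the
  -- order of `p - q` by one, and `q` does not vanish there.
  obtain ⟨s, hs, hsd⟩ := exists_eq_pow_rootMultiplicity_mul_and_not_dvd (p - q) hr 1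
  have hm : 0 < (p - q).rootMultiplicity 1 := by
    rw [rootMultiplicity_pos hr]
    simp [hpq]
  generalize (p - q).rootMultiplicity 1 = m at hs hm
  obtain ⟨m, rfl⟩ := Nat.exists_eq_succ_of_ne_zero hm.ne'
  have h2 : derivative (p - q) * q = derivative q * (p - q) := by
    rw [derivative_sub]
    linear_combination h
  rw [hs, derivative_mul, derivative_pow_succ] at h2
  have h3 : (X - C (1 : ℝ)) ^ m * (C (m + 1 : ℝ) * s * q + (X - C 1) * derivative s * q)
      = (X - C (1 : ℝ)) ^ m * ((X - C 1) * s * derivative q) := by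
    simp only [derivative_sub, derivative_X, derivative_C, sub_zero, mul_one] at h2
    rw [Nat.succ_eq_add_one, pow_succ] at h2
    linear_combination h2
  have h4 := congrArg (eval 1) (mul_left_cancel₀ (pow_ne_zero m (X_sub_C_ne_zero 1)) h3)
  simp only [eval_add, eval_mul, eval_sub, eval_X, eval_C, sub_self, zero_mul, add_zero,
    mul_eq_zero, hq, or_false] at h4
  rcases h4 with h4 | h4
  · exact absurd h4 (by positivity)
  · exact hsd (dvd_iff_isRoot.2 h4)

/-- Mean of the exponents `t j` with weights `z ^ t j`. -/
def boltzmannMean {n : ℕ} (t : Fin n → ℕ) (z : ℝ) : ℝ :=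
  (∑ j, t j * z ^ t j) / ∑ j, z ^ t j

open Polynomial in
-- Infinitely many coincidences force a polynomial identity between the logarithmic derivatives of
-- `∑ X ^ t j` and `∑ X ^ t' j`. Both sums equal `n` at `1`, so they agree, and so do their
-- exponents.
theorem finite_boltzmannMean_eq {n : ℕ} {t t' : Fin n → ℕ} (h : ∃ j, ∀ j', t' j' ≠ t j) :
    {z : ℝ | 0 < z ∧ boltzmannMean t z = boltzmannMean t' z}.Finite := by
  obtain ⟨j, hj⟩ := h
  have : NeZero n := ⟨by rintro rfl; exact j.elim0⟩
  let P : (Fin n → ℕ) → ℝ[X] := fun t => ∑ j, X ^ t j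
  have hP (t : Fin n → ℕ) (z : ℝ) : (P t).eval z = ∑ j, z ^ t j := by
    simp [P, eval_finsetSum]
  have hD (t : Fin n → ℕ) (z : ℝ) : (X * derivative (P t)).eval z = ∑ j, t j * z ^ t j := by
    simp only [P, derivative_sum, derivative_X_pow, eval_mul, eval_X, eval_finsetSum, eval_C,
      eval_pow, Finset.mul_sum]
    refine Finset.sum_congr rfl fun j _ => ?_
    rcases Nat.eq_zero_or_eq_succ_pred (t j) with h | h
    · simp [h]
    · rw [h]
      simp [pow_succ]
      ring
  have hpos (t : Fin n → ℕ) {z : ℝ} (hz : 0 < z) : 0 < ∑ j, z ^ t j :=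
    Finset.sum_pos (fun j _ => pow_pos hz _) Finset.univ_nonempty
  by_contra hinf
  have hW : X * derivative (P t) * P t' - X * derivative (P t') * P t = 0 := by
    refine eq_zero_of_infinite_isRoot _ (Set.Infinite.mono ?_ hinf)
    rintro z ⟨hz, he⟩
    rw [boltzmannMean, boltzmannMean, div_eq_div_iff (hpos t hz).ne' (hpos t' hz).ne'] at he
    change eval z _ = 0
    rw [eval_sub, eval_mul (q := P t'), eval_mul (q := P t), hD, hD, hP, hP, he, sub_self]
  have hPP : P t = P t' := by
    refine eq_of_derivative_mul_eq (by simp [hP]) ?_ ?_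
    · rw [hP]
      exact (hpos t' one_pos).ne'
    · refine mul_left_cancel₀ X_ne_zero ?_
      linear_combination hW
  have hc := congrArg (fun p => p.coeff (t j)) hPP
  simp only [P, finsetSum_coeff, coeff_X_pow] at hc
  have h0 : ∑ x, (if t j = t' x then (1 : ℝ) else 0) = 0 :=
    Finset.sum_eq_zero fun x _ => if_neg fun h => hj x h.symm
  have h1 : 0 < ∑ x, (if t j = t x then (1 : ℝ) else 0) :=
    Finset.sum_pos' (fun x _ => by positivity) ⟨j, Finset.mem_univ _, by simp⟩
  rw [hc, h0] at h1
  exact h1.false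

/-- Since `s ↦ exp (s² t)` is injective on `s > 0` for `t > 0`, each pair of contexts and each row
exclude only finitely many `s`. -/
theorem exists_scale_boltzmannMean_ne {n : ℕ} {ι : Type*} [Finite ι] (t : ι → Fin n → ℕ)
    (hpos : ∀ k i, 0 < t k i) (hsep : ∀ k l, k ≠ l → ∃ j, ∀ j', t l j' ≠ t k j) :
    ∃ s : ℝ, ∀ k l, k ≠ l → ∀ i,
      boltzmannMean (t k) (Real.exp (s * s * t k i)) ≠
        boltzmannMean (t l) (Real.exp (s * s * t k i)) := by
  let B : {q : ι × ι // q.1 ≠ q.2} × Fin n → Set ℝ := fun q => {s | 0 < s ∧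
    boltzmannMean (t q.1.1.1) (Real.exp (s * s * t q.1.1.1 q.2)) =
      boltzmannMean (t q.1.1.2) (Real.exp (s * s * t q.1.1.1 q.2))}
  have hB (q) : (B q).Finite := by
    have hfin := finite_boltzmannMean_eq (hsep q.1.1.1 q.1.1.2 q.1.2)
    have ht : (0 : ℝ) < t q.1.1.1 q.2 := by exact_mod_cast hpos _ _
    refine Set.Finite.of_finite_image
      (f := fun s : ℝ => Real.exp (s * s * t q.1.1.1 q.2)) (hfin.subset ?_) ?_
    · rintro _ ⟨s, hs, rfl⟩
      exact ⟨Real.exp_pos _, hs.2⟩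
    · intro s hs s' hs' h
      have h1 := mul_right_cancel₀ ht.ne' (Real.exp_injective h)
      exact (mul_self_inj hs.1.le hs'.1.le).1 h1
  obtain ⟨s, hs0, hs⟩ := ((Set.Ioi_infinite (0 : ℝ)).sdiff (Set.finite_iUnion hB)).nonempty
  refine ⟨s, fun k l hkl i h => hs (Set.mem_iUnion.2 ⟨(⟨(k, l), hkl⟩, i), hs0, h⟩)⟩

end Boltzmann

theorem exists_add_mul_ne_zero {ι : Type*} [Finite ι] (a b : ι → ℝ)
    (h : ∀ k, a k = 0 → b k ≠ 0) : ∃ w : ℝ, ∀ k, a k + w * b k ≠ 0 := by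
  obtain ⟨w, hw⟩ := (Set.finite_range fun k => -a k / b k).infinite_compl.nonempty
  refine ⟨w, fun k hk => ?_⟩
  by_cases hb : b k = 0
  · exact h k (by simpa [hb] using hk) hb
  · exact hw ⟨k, by field_simp; linarith⟩

/-! ### Exact interpolation on finite sets -/

section Interpolation

variable {n d : ℕ} {Θ : Fin 2 → Type*}
  {A : (h : Fin 2) → Θ h → Matrix (Fin n) (Fin d) ℝ → Matrix (Fin n) (Fin n) ℝ}

theorem exists_dotProduct_separating (hd : 0 < d) (S : Finset (Fin d → ℝ)) :
    ∃ u : Fin d → ℝ, 0 < u ⬝ᵥ u ∧ ∀ s ∈ S, ∀ t ∈ S, s ≠ t → u ⬝ᵥ s ≠ u ⬝ᵥ t := by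
  obtain ⟨f, hf⟩ := Module.exists_dual_forall_apply_ne_zero (K := ℝ) (M := Fin d → ℝ)
    -- The `none` index forces `u ≠ 0` even when `S` has no two points.
    (ι := Option {q : S × S // q.1 ≠ q.2})
    (fun o => o.elim (Pi.single ⟨0, hd⟩ 1) fun q => q.1.1.1 - q.1.2.1) (by
      rintro (_ | ⟨q, hq⟩)
      · exact Pi.single_ne_zero_iff.2 one_ne_zero
      · exact sub_ne_zero.2 fun h => hq (Subtype.ext h))
  let u : Fin d → ℝ := fun i => f fun j => if i = j then 1 else 0
  have hu (x) : f x = u ⬝ᵥ x := by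
    rw [LinearMap.pi_apply_eq_sum_univ f x]
    simp [u, dotProduct, mul_comm]
  refine ⟨u, ?_, fun s hs t ht hst h => ?_⟩
  · have h0 : u ≠ 0 := fun h => hf none (by rw [hu, h, zero_dotProduct])
    have := dotProduct_self_eq_zero (v := u)
    exact lt_of_le_of_ne (Finset.sum_nonneg fun i _ => mul_self_nonneg _)
      fun h => h0 (this.1 h.symm)
  · refine hf (some ⟨(⟨s, hs⟩, ⟨t, ht⟩), by simpa using hst⟩) ?_
    rw [hu]
    simp [dotProduct_sub, h]

theorem mapRows_comp (g₁ g₂ : (Fin d → ℝ) → (Fin d → ℝ)) :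
    mapRows (n := n) (g₁ ∘ g₂) = mapRows g₁ ∘ mapRows g₂ := rfl

/-- Feed-forward layers interpolate on finite sets of rows. -/
theorem exists_mapRows_eqOn [Nonempty ((h : Fin 2) → Θ h)] (hd : 0 < d)
    (S : Finset (Fin d → ℝ)) (F : (Fin d → ℝ) → (Fin d → ℝ)) :
    ∃ g, mapRows g ∈ continuousTransformers A ∧ ∀ s ∈ S, g s = F s := by
  obtain ⟨u, hu, hsep⟩ := exists_dotProduct_separating hd S
  -- After a shift by `K • u`, waiting points project beyond every target, so points already placed
  -- never meet them.
  obtain ⟨K, hK⟩ : ∃ K : ℝ, ∀ s ∈ S, ∀ t ∈ S, u ⬝ᵥ F t - u ⬝ᵥ s < K * (u ⬝ᵥ u) := by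
    have : ∀ᶠ K : ℝ in Filter.atTop, ∀ s ∈ S, ∀ t ∈ S,
        u ⬝ᵥ F t - u ⬝ᵥ s < K * (u ⬝ᵥ u) := by
      simp only [Filter.eventually_all_finset]
      intro s _ t _
      exact (Filter.tendsto_id.atTop_mul_const hu).eventually_gt_atTop _
    exact this.exists
  suffices H : ∀ T : Finset (Fin d → ℝ), T ⊆ S → ∃ g, mapRows g ∈ continuousTransformers A ∧
      (∀ s ∈ T, g s = F s) ∧ ∀ s ∈ S, s ∉ T → g s = s + K • u by
    obtain ⟨g, hg, h, -⟩ := H S subset_rfl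
    exact ⟨g, hg, h⟩
  classical
  intro T
  induction T using Finset.induction_on with
  | empty =>
    refine fun _ => ⟨_, mapRows_ridge_mem 0 0 0 0 0 (K • u), by simp, fun s _ _ => ?_⟩
    simp [ridge]
  | insert s₀ T hs₀ ih =>
    intro hT
    obtain ⟨hs₀S, hTS⟩ := Finset.insert_subset_iff.1 hT
    obtain ⟨g, hg, hgT, hgS⟩ := ih hTS
    -- The tent around the point to be moved must miss the current images of all others.
    obtain ⟨r, hr, hr0⟩ : ∃ r : ℝ, (∀ s ∈ S, s ≠ s₀ →
        r ≤ |u ⬝ᵥ g s - u ⬝ᵥ (s₀ + K • u)|) ∧ 0 < r := by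
      have : ∀ᶠ r : ℝ in nhdsWithin 0 (Set.Ioi 0), (∀ s ∈ S, s ≠ s₀ →
          r ≤ |u ⬝ᵥ g s - u ⬝ᵥ (s₀ + K • u)|) ∧ 0 < r := by
        refine Filter.Eventually.and ?_ self_mem_nhdsWithin
        rw [Filter.eventually_all_finset]
        intro s hs
        refine Filter.eventually_imp_distrib_left.2 fun hne => ?_
        refine Filter.Eventually.filter_mono nhdsWithin_le_nhds (eventually_le_nhds ?_)
        rw [abs_pos, sub_ne_zero, dotProduct_add, dotProduct_smul, smul_eq_mul]
        by_cases hsT : s ∈ T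
        · rw [hgT s hsT]
          have := hK s₀ hs₀S s hs
          intro h
          linarith
        · rw [hgS s hs hsT, dotProduct_add, dotProduct_smul, smul_eq_mul]
          intro h
          exact hsep s hs s₀ hs₀S hne (add_right_cancel h)
      exact this.exists
    obtain ⟨m, hm, hm1, hm2⟩ := exists_mapRows_move (A := A) u (F s₀ - (s₀ + K • u))
      (u ⬝ᵥ (s₀ + K • u)) hr0
    refine ⟨m ∘ g, by
      rw [mapRows_comp]
      exact comp_mem_continuousTransformers hm hg, ?_, ?_⟩
    · intro s hs
      rcases Finset.mem_insert.1 hs with rfl | hs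
      · rw [Function.comp_apply, hgS s hs₀S hs₀, hm1 _ rfl]
        abel
      · have hne : s ≠ s₀ := fun h => hs₀ (h ▸ hs)
        rw [Function.comp_apply, hm2 _ (hr s (hTS hs) hne), hgT s hs]
    · intro s hs hsT
      have hne : s ≠ s₀ := fun h => hsT (h ▸ Finset.mem_insert_self _ _)
      rw [Function.comp_apply, hm2 _ (hr s hs hne),
        hgS s hs fun h => hsT (Finset.mem_insert_of_mem h)]

theorem exists_mapRows_interpolate [Nonempty ((h : Fin 2) → Θ h)] (hd : 0 < d) {ι : Type*}
    [Finite ι] (a b : ι → Fin d → ℝ) (hab : b.FactorsThrough a) :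
    ∃ g, mapRows g ∈ continuousTransformers A ∧ ∀ k, g (a k) = b k := by
  obtain ⟨g, hg, h⟩ := exists_mapRows_eqOn (A := A) hd (Set.finite_range a).toFinset
    (Function.extend a b 0)
  refine ⟨g, hg, fun k => ?_⟩
  rw [h _ (by simp), hab.extend_apply]

theorem attention_mem_continuousTransformers (h₀ : Attentive (A 0)) [Nonempty (Θ 1)]
    (u a w : Fin d → ℝ) :
    (fun X => X + vecMulVec (rowSoftmax (vecMulVec (X *ᵥ u) (X *ᵥ u)) *ᵥ (X *ᵥ a)) w)
      ∈ continuousTransformers A := by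
  obtain ⟨θ₀, hθ₀⟩ := h₀ u 0
  obtain ⟨θ₁⟩ := ‹Nonempty (Θ 1)›
  constructor
  · have := attention_mem_transformers (A := A) (Fin.cons θ₀ (Fin.cons θ₁ fun i => i.elim0)) w a 0
    convert this using 6 with X
    · simp [hθ₀, ← Pi.zero_def]
    · simp
  · refine continuous_matrix fun i j => ?_
    have hX (i : Fin n) (x : Fin d) : Continuous fun X : Matrix (Fin n) (Fin d) ℝ => X i x :=
      continuous_id.matrix_elem i x
    simp only [Matrix.add_apply, vecMulVec_apply, mulVec, dotProduct, rowSoftmax, Matrix.of_apply]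
    have hne (X : Matrix (Fin n) (Fin d) ℝ) :
        ∑ k, Real.exp ((∑ l, X i l * u l) * ∑ l, X k l * u l) ≠ 0 :=
      (Finset.sum_pos (fun _ _ => Real.exp_pos _) ⟨i, Finset.mem_univ i⟩).ne'
    fun_prop (disch := exact hne)

/-- With zero value matrix and value bias `1`, the head outputs `A(X) 1 = v` for every input. -/
theorem exists_position_mem_continuousTransformers (h₀ : PositionAware (A 0)) [Nonempty (Θ 1)] :
    ∃ v : Fin n → ℝ, Function.Injective v ∧ ∀ w : Fin d → ℝ,
      (fun X => X + vecMulVec v w) ∈ continuousTransformers A := by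
  obtain ⟨θ₀, v, hv, hθ₀⟩ := h₀
  obtain ⟨θ₁⟩ := ‹Nonempty (Θ 1)›
  refine ⟨v, hv, fun w => ⟨?_, by fun_prop⟩⟩
  have := attention_mem_transformers (A := A) (Fin.cons θ₀ (Fin.cons θ₁ fun i => i.elim0)) w 0 1
  convert this using 4 with X
  simp [hθ₀]

/-- Transformers interpolate on finite sets of inputs. -/
theorem exists_transformer_eqOn (hd : 0 < d) (hatt : Attentive (A 0))
    (hpos : PositionAware (A 0)) [Nonempty (Θ 1)] {G : Set (Matrix (Fin n) (Fin d) ℝ)}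
    (hG : G.Finite) (F : Matrix (Fin n) (Fin d) ℝ → Matrix (Fin n) (Fin d) ℝ) :
    ∃ T ∈ continuousTransformers A, ∀ X ∈ G, T X = F X := by
  have : Finite G := hG
  have : Nonempty ((h : Fin 2) → Θ h) := by
    obtain ⟨θ₀, -⟩ := hpos
    obtain ⟨θ₁⟩ := ‹Nonempty (Θ 1)›
    exact ⟨Fin.cons θ₀ (Fin.cons θ₁ fun i => i.elim0)⟩
  let o : Fin d := ⟨0, hd⟩
  let e : Fin d → ℝ := Pi.single o 1
  -- Position-dependent tokens.
  obtain ⟨v, hv, hpe⟩ := exists_position_mem_continuousTransformers (A := A) hpos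
  obtain ⟨K, hK⟩ := exists_add_mul_ne_zero
    (ι := G × G × {q : Fin n × Fin n // q.1 ≠ q.2})
    (fun k => k.1.1 k.2.2.1.1 o - k.2.1.1 k.2.2.1.2 o)
    (fun k => v k.2.2.1.1 - v k.2.2.1.2)
    (fun k _ => sub_ne_zero.2 (hv.ne k.2.2.2))
  let a : G × Fin n → Fin d → ℝ := fun k => (k.1.1 + vecMulVec v (K • e)) k.2
  have ha {k l : G × Fin n} (h : a k = a l) : k.2 = l.2 ∧ k.1.1 k.2 = l.1.1 l.2 := by
    have hi : k.2 = l.2 := by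
      by_contra hne
      refine hK (k.1, l.1, ⟨(k.2, l.2), hne⟩) ?_
      have := congrFun h o
      simp only [a, e, Matrix.add_apply, vecMulVec_apply, Pi.smul_apply, Pi.single_eq_same,
        smul_eq_mul, mul_one] at this
      linear_combination this
    refine ⟨hi, funext fun j => ?_⟩
    have := congrFun h j
    simpa [a, Matrix.add_apply, vecMulVec_apply, hi] using this
  -- Scalar tokens.
  obtain ⟨τ, hτ⟩ := Set.countable_iff_exists_injOn.1 (Set.finite_range a).countable
  -- The `+ 1` gives the positivity needed to choose the scale `s`.
  let t : G → Fin n → ℕ := fun X i => τ (a (X, i)) + 1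
  have ht {X Y : G} {i j : Fin n} (h : t X i = t Y j) : i = j ∧ X.1 i = Y.1 j :=
    ha (hτ ⟨_, rfl⟩ ⟨_, rfl⟩ (Nat.succ_injective h))
  obtain ⟨g₁, hg₁, hg₁t⟩ := exists_mapRows_interpolate (A := A) hd a
    (fun k => (t k.1 k.2 : ℝ) • e) (fun k l h => by simp only [t, Prod.mk.eta, h])
  -- Contextual tokens.
  obtain ⟨s, hs⟩ := exists_scale_boltzmannMean_ne t (fun _ _ => Nat.succ_pos _) (by
    intro X Y hXY
    by_contra! hcon
    refine hXY (Subtype.ext (funext fun i => ?_))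
    obtain ⟨j, hj⟩ := hcon i
    obtain ⟨rfl, h⟩ := ht hj
    exact h.symm)
  let m : G → Fin n → ℝ := fun X i => boltzmannMean (t X) (Real.exp (s * s * t X i))
  -- If two integer tokens agree, they share their position and come from different inputs, so their
  -- means differ; a generic `w` handles all pairs.
  obtain ⟨w, hw⟩ := exists_add_mul_ne_zero
    (ι := {q : (G × Fin n) × (G × Fin n) // q.1 ≠ q.2})
    (fun q => (t q.1.1.1 q.1.1.2 : ℝ) - t q.1.2.1 q.1.2.2)
    (fun q => m q.1.1.1 q.1.1.2 - m q.1.2.1 q.1.2.2) (by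
      rintro ⟨⟨⟨X, i⟩, ⟨Y, j⟩⟩, hne⟩ h
      have h' : t X i = t Y j := by exact_mod_cast sub_eq_zero.1 h
      obtain ⟨rfl, -⟩ := ht h'
      have hXY : X ≠ Y := fun h => hne (by rw [h])
      rw [sub_ne_zero]
      simp only [m, ← h']
      exact hs X Y hXY i)
  let y : G × Fin n → Fin d → ℝ := fun k => (t k.1 k.2 + w * m k.1 k.2) • e
  have hy : Function.Injective y := by
    intro k l h
    by_contra hne
    refine hw ⟨(k, l), hne⟩ ?_
    have := congrFun h o
    simp only [y, e, Pi.smul_apply, Pi.single_eq_same, smul_eq_mul, mul_one] at this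
    linear_combination this
  obtain ⟨g₂, hg₂, hg₂y⟩ := exists_mapRows_interpolate (A := A) hd y
    (fun k => F k.1.1 k.2) (fun k l h => by rw [hy h])
  refine ⟨_, comp_mem_continuousTransformers hg₂ (comp_mem_continuousTransformers
    (attention_mem_continuousTransformers hatt (s • e) e (w • e))
    (comp_mem_continuousTransformers hg₁ (hpe (K • e)))), fun X hX => ?_⟩
  have h1 : mapRows g₁ (X + vecMulVec v (K • e)) =
      vecMulVec (fun i => (t ⟨X, hX⟩ i : ℝ)) e := by
    ext i j
    simp only [mapRows, Matrix.of_apply]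
    have := congrFun (hg₁t (⟨X, hX⟩, i)) j
    simpa [a, vecMulVec_apply] using this
  simp only [Function.comp_apply, h1]
  generalize ht' : t ⟨X, hX⟩ = t'
  have he : e ⬝ᵥ e = 1 := by simp [e]
  have h2 : vecMulVec (fun i => (t' i : ℝ)) e *ᵥ e = fun i => (t' i : ℝ) := by
    rw [vecMulVec_mulVec]
    simp [he]
  ext i j
  rw [mulVec_smul, h2]
  have h3 : (rowSoftmax (vecMulVec (s • fun i => (t' i : ℝ)) (s • fun i => (t' i : ℝ))) *ᵥ
      fun i => (t' i : ℝ)) i = boltzmannMean t' (Real.exp (s * s * t' i)) := by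
    simp only [mulVec, dotProduct, rowSoftmax, vecMulVec_apply, boltzmannMean, Matrix.of_apply,
      Pi.smul_apply, smul_eq_mul, Finset.sum_div]
    have hexp (j) : Real.exp (s * t' i * (s * t' j)) = Real.exp (s * s * t' i) ^ t' j := by
      rw [← Real.exp_nat_mul]
      ring_nf
    simp only [hexp]
    exact Finset.sum_congr rfl fun j _ => by ring
  have h4 := congrFun (hg₂y (⟨X, hX⟩, i)) j
  rw [← h4]
  simp only [mapRows, Matrix.of_apply]
  refine congrFun (congrArg g₂ (funext fun l => ?_)) j
  simp only [Matrix.add_apply, vecMulVec_apply, h3, y, m, ht', Pi.smul_apply, smul_eq_mul]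
  ring

end Interpolation

/-! ### Entrywise maps and quantization -/

section Entrywise

variable {n d : ℕ} {Θ : Fin 2 → Type*}
  {A : (h : Fin 2) → Θ h → Matrix (Fin n) (Fin d) ℝ → Matrix (Fin n) (Fin n) ℝ}

/-- A ridge along a coordinate vector spends all four hidden units on one coordinate, so one block
per coordinate suffices. -/
theorem map_mem_continuousTransformers [Nonempty ((h : Fin 2) → Θ h)] (a σ b : Fin 4 → ℝ)
    {φ : ℝ → ℝ} (hφ : ∀ t, φ t = t + ∑ k, a k * max (σ k * t + b k) 0) :
    (fun X => X.map φ) ∈ continuousTransformers A := by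
  suffices H : ∀ s : Finset (Fin d),
      mapRows (fun x j => if j ∈ s then φ (x j) else x j) ∈ continuousTransformers A by
    convert H Finset.univ using 1
    funext X
    ext i j
    simp [mapRows]
  intro s
  induction s using Finset.induction_on with
  | empty =>
    simp only [Finset.notMem_empty, if_false]
    exact id_mem_continuousTransformers
  | insert j s hj ih =>
    convert comp_mem_continuousTransformers ih
      (mapRows_ridge_mem a σ b (Pi.single j 1) (Pi.single j 1) 0) using 1
    funext X
    ext i l
    simp only [mapRows, ridge, Function.comp_apply, Matrix.of_apply]
    by_cases hl : l = j
    · subst hl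
      simp [hj, hφ]
    · simp [hl]

/-- For `M ≥ 0` this is truncation to `[-M, M]`. -/
theorem clip_mem_continuousTransformers [Nonempty ((h : Fin 2) → Θ h)] (M : ℝ) :
    (fun X => X.map fun t => t + max (-t - M) 0 - max (t - M) 0) ∈ continuousTransformers A := by
  refine map_mem_continuousTransformers ![1, -1, 0, 0] ![-1, 1, 0, 0] ![-M, -M, 0, 0] fun t => ?_
  simp [Fin.sum_univ_four]
  ring_nf

/-- The interval `[c, c + δ - η]` can be collapsed to `c`, changing nothing outside
`(c, c + δ)`. -/
theorem exists_collapse [Nonempty ((h : Fin 2) → Θ h)] (c : ℝ) {δ η : ℝ} (hη : 0 < η)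
    (hηδ : η < δ) :
    ∃ φ : ℝ → ℝ, (fun X => X.map φ) ∈ continuousTransformers A ∧
      (∀ t, c ≤ t → t ≤ c + δ - η → φ t = c) ∧ ∀ t, t < c ∨ c + δ ≤ t → φ t = t := by
  -- The successive slopes are `1, 0, δ / η, 1`; the steep piece of length `η` regains the lost
  -- height.
  refine ⟨_, map_mem_continuousTransformers ![-1, δ / η, -(δ / η - 1), 0] ![1, 1, 1, 0]
    ![-c, -(c + δ - η), -(c + δ), 0] fun _ => rfl, fun t h1 h2 => ?_, fun t h => ?_⟩
  · simp only [Fin.sum_univ_four, cons_val_zero, cons_val_one, cons_val, one_mul, zero_mul,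
      add_zero]
    rw [max_eq_left (by linarith), max_eq_right (by linarith), max_eq_right (by linarith)]
    ring
  · simp only [Fin.sum_univ_four, cons_val_zero, cons_val_one, cons_val, one_mul, zero_mul,
      add_zero]
    rcases h with h | h
    · rw [max_eq_right (by linarith), max_eq_right (by linarith), max_eq_right (by linarith)]
      ring
    · rw [max_eq_left (by linarith), max_eq_left (by linarith), max_eq_left (by linarith)]
      field_simp
      ring

/-- Collapses of distinct cells do not interact: each fixes everything outside its cell and sends
the collapsed part to the left endpoint, still in that cell. The last clause carries the induction.
-/
theorem exists_quantize [Nonempty ((h : Fin 2) → Θ h)] {δ η : ℝ} (hη : 0 < η) (hηδ : η < δ)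
    (s : Finset ℤ) :
    ∃ φ : ℝ → ℝ, (fun X => X.map φ) ∈ continuousTransformers A ∧
      (∀ t, ⌊t / δ⌋ ∈ s → t ≤ ⌊t / δ⌋ * δ + δ - η → φ t = ⌊t / δ⌋ * δ) ∧
      ∀ t, ⌊t / δ⌋ ∉ s → φ t = t := by
  have hδ : 0 < δ := hη.trans hηδ
  induction s using Finset.induction_on with
  | empty => exact ⟨fun t => t, by simpa using id_mem_continuousTransformers (A := A), by simp⟩
  | insert k s hk ih =>
    obtain ⟨φ, hφ, h1, h2⟩ := ih
    obtain ⟨χ, hχ, h3, h4⟩ := exists_collapse (A := A) (k * δ) hη hηδ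
    have hne {t : ℝ} (ht : ⌊t / δ⌋ ≠ k) : χ t = t := by
      refine h4 t ?_
      by_contra! hcon
      refine ht (Int.floor_eq_iff.2 ⟨(le_div_iff₀ hδ).2 hcon.1, (div_lt_iff₀ hδ).2 ?_⟩)
      linarith [hcon.2]
    have hmem : (fun X => X.map (φ ∘ χ)) ∈ continuousTransformers A :=
      comp_mem_continuousTransformers (g₁ := fun X => X.map φ) (g₂ := fun X => X.map χ) hφ hχ
    refine ⟨φ ∘ χ, hmem, fun t ht hle => ?_, fun t ht => ?_⟩
    · by_cases htk : ⌊t / δ⌋ = k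
      · have hχt : χ t = k * δ := by
          rw [htk] at hle
          exact h3 t ((le_div_iff₀ hδ).1 (Int.floor_eq_iff.1 htk).1) hle
        rw [Function.comp_apply, hχt, htk]
        refine h2 _ ?_
        rwa [mul_div_cancel_right₀ _ hδ.ne', Int.floor_intCast]
      · rw [Function.comp_apply, hne htk]
        exact h1 t ((Finset.mem_insert.1 ht).resolve_left htk) hle
    · rw [Finset.mem_insert, not_or] at ht
      rw [Function.comp_apply, hne ht.1, h2 t ht.2]

end Entrywise

/-! ### Approximation and passage to the limit -/

theorem entryNorm_rpow {m k : ℕ} {p : ℝ} (hp : p ≠ 0) (M : Matrix (Fin m) (Fin k) ℝ) :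
    entryNorm p M ^ p = ∑ i, ∑ j, |M i j| ^ p := by
  rw [entryNorm, one_div, Real.rpow_inv_rpow _ hp]
  exact Finset.sum_nonneg fun i _ => Finset.sum_nonneg fun j _ => Real.rpow_nonneg (abs_nonneg _) _

theorem sum_abs_rpow_le {m k : ℕ} {p C : ℝ} (hp : 0 ≤ p) {M : Matrix (Fin m) (Fin k) ℝ}
    (h : ∀ i j, |M i j| ≤ C) : ∑ i, ∑ j, |M i j| ^ p ≤ m * k * C ^ p := by
  calc ∑ i, ∑ j, |M i j| ^ p ≤ ∑ _i : Fin m, ∑ _j : Fin k, C ^ p :=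
        Finset.sum_le_sum fun i _ => Finset.sum_le_sum fun j _ =>
          Real.rpow_le_rpow (abs_nonneg _) (h i j) hp
    _ = m * k * C ^ p := by simp [mul_assoc]

/-- A continuous map on a compact set is a pointwise limit, up to a uniformly small error, of
uniformly bounded continuous Transformers. -/
theorem exists_seq_continuousTransformers {n d : ℕ} (hd : 0 < d)
    {D : Set (Fin n → Fin d → ℝ)} (hD : IsCompact D)
    {f : (Fin n → Fin d → ℝ) → (Fin n → Fin d → ℝ)} (hf : ContinuousOn f D)
    {Θ : Fin 2 → Type*}
    {A : (h : Fin 2) → Θ h → Matrix (Fin n) (Fin d) ℝ → Matrix (Fin n) (Fin n) ℝ}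
    (hatt : Attentive (A 0)) (hpos : PositionAware (A 0)) [Nonempty (Θ 1)] {ε : ℝ} (hε : 0 < ε) :
    ∃ (g : ℕ → Matrix (Fin n) (Fin d) ℝ → Matrix (Fin n) (Fin d) ℝ)
      (F : (Fin n → Fin d → ℝ) → (Fin n → Fin d → ℝ)) (C : ℝ),
      (∀ m, g m ∈ continuousTransformers A) ∧
      (∀ X ∈ D, ∀ m i j, |f X i j - g m (Matrix.of X) i j| ≤ C) ∧
      (∀ X ∈ D, ∀ i j, |f X i j - F X i j| ≤ ε) ∧
      ∀ X ∈ D, ∀ᶠ m in Filter.atTop, g m (Matrix.of X) = Matrix.of (F X) := by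
  have : Nonempty ((h : Fin 2) → Θ h) := by
    obtain ⟨θ₀, -⟩ := hpos
    obtain ⟨θ₁⟩ := ‹Nonempty (Θ 1)›
    exact ⟨Fin.cons θ₀ (Fin.cons θ₁ fun i => i.elim0)⟩
  obtain ⟨M, hM0, hM⟩ : ∃ M : ℝ, 0 ≤ M ∧ ∀ X ∈ D, ∀ i j, |f X i j| ≤ M := by
    obtain ⟨M, hM⟩ := hD.exists_bound_of_continuousOn hf
    exact ⟨max M 0, le_max_right _ _, fun X hX i j =>
      ((norm_le_pi_norm (f X i) j).trans (norm_le_pi_norm (f X) i)).trans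
        ((hM X hX).trans (le_max_left _ _))⟩
  obtain ⟨R, hR⟩ : ∃ R : ℝ, ∀ X ∈ D, ∀ i j, |X i j| ≤ R := by
    obtain ⟨R, hR⟩ := hD.exists_bound_of_continuousOn continuousOn_id
    exact ⟨R, fun X hX i j => ((norm_le_pi_norm (X i) j).trans (norm_le_pi_norm X i)).trans
      (hR X hX)⟩
  obtain ⟨δ, hδ, hδf⟩ :=
    Metric.uniformContinuousOn_iff.1 (hD.uniformContinuousOn_of_continuous hf) ε hε
  let s : Finset ℤ := Finset.Icc ⌊-R / δ⌋ ⌊R / δ⌋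
  have hs {X} (hX : X ∈ D) (i j) : ⌊X i j / δ⌋ ∈ s := by
    obtain ⟨h1, h2⟩ := abs_le.1 (hR X hX i j)
    exact Finset.mem_Icc.2 ⟨Int.floor_mono (by gcongr), Int.floor_mono (by gcongr)⟩
  let q : (Fin n → Fin d → ℝ) → Matrix (Fin n) (Fin d) ℝ :=
    fun X => Matrix.of fun i j => ⌊X i j / δ⌋ * δ
  have hG : (q '' D).Finite := by
    refine (Set.finite_range fun κ : Fin n → Fin d → s =>
      (Matrix.of fun i j => ((κ i j : ℤ) : ℝ) * δ)).subset ?_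
    rintro _ ⟨X, hX, rfl⟩
    exact ⟨fun i j => ⟨_, hs hX i j⟩, rfl⟩
  -- Grid corners may lie outside `D`, so each takes the value of `f` at a point of `D` in its cell.
  let r : Matrix (Fin n) (Fin d) ℝ → (Fin n → Fin d → ℝ) := Function.invFunOn q D
  have hr {X} (hX : X ∈ D) : r (q X) ∈ D := Function.invFunOn_mem ⟨X, hX, rfl⟩
  have hqr {X} (hX : X ∈ D) : q (r (q X)) = q X := Function.invFunOn_eq ⟨X, hX, rfl⟩
  have hdist {X} (hX : X ∈ D) : dist X (r (q X)) < δ := by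
    refine (dist_pi_lt_iff hδ).2 fun i => (dist_pi_lt_iff hδ).2 fun j => ?_
    have h := congrFun (congrFun (hqr hX) i) j
    have h' := Int.cast_injective (mul_right_cancel₀ hδ.ne' h)
    have := Int.abs_sub_lt_one_of_floor_eq_floor h'.symm
    rwa [← sub_div, abs_div, abs_of_pos hδ, div_lt_one hδ] at this
  obtain ⟨T, hT, hTG⟩ := exists_transformer_eqOn hd hatt hpos hG fun Y => Matrix.of (f (r Y))
  -- Only the gap depends on `m`, not `T`; the `+ 2` keeps it below `δ` at `m = 0`.
  have hη (m : ℕ) : 0 < δ / (m + 2) ∧ δ / (m + 2) < δ :=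
    ⟨by positivity, div_lt_self hδ (by linarith [(Nat.cast_nonneg m : (0 : ℝ) ≤ m)])⟩
  choose φ hφ hφq _ using fun m : ℕ => exists_quantize (A := A) (hη m).1 (hη m).2 s
  refine ⟨fun m => _, fun X => f (r (q X)), M + M, fun m =>
    comp_mem_continuousTransformers (clip_mem_continuousTransformers M)
      (comp_mem_continuousTransformers hT (hφ m)), fun X hX m i j => ?_, fun X hX i j => ?_,
    fun X hX => ?_⟩
  · refine (abs_sub _ _).trans (add_le_add (hM X hX i j) ?_)
    simp only [Function.comp_apply, Matrix.map_apply]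
    generalize T _ i j = t
    rw [abs_le]
    rcases max_cases (-t - M) 0 with h | h <;> rcases max_cases (t - M) 0 with h' | h' <;>
      constructor <;> linarith
  · have := (hδf X hX _ (hr hX) (hdist hX)).le
    exact ((dist_le_pi_dist (f X i) _ j).trans (dist_le_pi_dist (f X) _ i)).trans this
  -- Cells are half-open, so each entry lies strictly below its upper end and eventually escapes the
  -- gap.
  · have hev : ∀ᶠ m : ℕ in Filter.atTop, ∀ i j, X i j ≤ ⌊X i j / δ⌋ * δ + δ - δ / (m + 2) := by
      simp only [Filter.eventually_all]
      intro i j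
      have hlim : Filter.Tendsto (fun m : ℕ => δ / ((m : ℝ) + 2)) Filter.atTop (nhds 0) :=
        Filter.Tendsto.const_div_atTop
          (Filter.tendsto_atTop_add_const_right _ _ tendsto_natCast_atTop_atTop) δ
      have hlt : 0 < ⌊X i j / δ⌋ * δ + δ - X i j := by
        have := (div_lt_iff₀ hδ).1 (Int.lt_floor_add_one (X i j / δ))
        linarith
      filter_upwards [hlim.eventually_le_const hlt] with m hm
      linarith
    filter_upwards [hev] with m hm
    have hq : (Matrix.of X).map (φ m) = q X := by
      ext i j
      exact hφq m _ (hs hX i j) (hm i j)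
    simp only [Function.comp_apply, hq, hTG _ ⟨X, hX, rfl⟩]
    ext i j
    obtain ⟨h1, h2⟩ := abs_le.1 (hM _ (hr hX) i j)
    simp only [Matrix.map_apply, Matrix.of_apply]
    rw [max_eq_right (by linarith), max_eq_right (by linarith)]
    ring

end

theorem theorem3 {n d : ℕ} (hn : 0 < n) (hd : 0 < d) {p : ℝ} (hp : 1 ≤ p) {ε : ℝ} (hε : 0 < ε)
    (D : Set (Matrix (Fin n) (Fin d) ℝ)) (hD : IsCompact D)
    (f : Matrix (Fin n) (Fin d) ℝ → Matrix (Fin n) (Fin d) ℝ) (hf : ContinuousOn f D)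
    {Θ : Fin 2 → Type*}
    (A : (h : Fin 2) → Θ h → Matrix (Fin n) (Fin d) ℝ → Matrix (Fin n) (Fin n) ℝ)
    (hatt : ∀ h, Attentive (A h)) (hpos : ∀ h, PositionAware (A h)) :
    ∃ g ∈ transformers A 1 4,
      IntegrableOn (fun X : Fin n → Fin d → ℝ =>
        entryNorm p (f (Matrix.of X) - g (Matrix.of X)) ^ p) (Matrix.of ⁻¹' D) volume ∧
      (∫ X in (Matrix.of ⁻¹' D : Set (Fin n → Fin d → ℝ)),
        entryNorm p (f (Matrix.of X) - g (Matrix.of X)) ^ p) ^ (1 / p) < ε := by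
  have hp0 : 0 < p := one_pos.trans_le hp
  have : Nonempty (Θ 1) := ⟨(hpos 1).choose⟩
  let D' : Set (Fin n → Fin d → ℝ) := Matrix.of ⁻¹' D
  have hD' : IsCompact D' := hD
  let f' : (Fin n → Fin d → ℝ) → (Fin n → Fin d → ℝ) := fun X => f (Matrix.of X)
  have hf' : ContinuousOn f' D' := hf
  let V : ℝ := n * d * volume.real D'
  have hV : 0 ≤ V := by positivity
  -- This makes the limiting error at most `ε ^ p * V / (V + 1)`; the `+ 1` covers `V = 0`.
  let ε' : ℝ := (ε ^ p / (V + 1)) ^ p⁻¹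
  have hε' : 0 < ε' := by positivity
  have hε'p : ε' ^ p = ε ^ p / (V + 1) := Real.rpow_inv_rpow (by positivity) hp0.ne'
  obtain ⟨g, F, C, hg, hC, hF, hgF⟩ :=
    exists_seq_continuousTransformers hd hD' hf' (hatt 0) (hpos 0) hε'
  simp only [entryNorm_rpow hp0.ne', Matrix.sub_apply]
  have hcont (m : ℕ) : ContinuousOn (fun X : Fin n → Fin d → ℝ =>
      ∑ i, ∑ j, |f (Matrix.of X) i j - g m (Matrix.of X) i j| ^ p) D' := by
    have h1 (i j) : ContinuousOn (fun X : Fin n → Fin d → ℝ => f (Matrix.of X) i j) D' :=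
      (continuous_apply_apply i j).comp_continuousOn hf'
    have h2 (i j) : ContinuousOn (fun X : Fin n → Fin d → ℝ => g m (Matrix.of X) i j) D' :=
      ((hg m).2.matrix_elem i j).continuousOn
    refine continuousOn_finsetSum _ fun i _ => continuousOn_finsetSum _ fun j _ => ?_
    exact ((h1 i j).sub (h2 i j)).abs.rpow_const fun _ _ => Or.inr hp0.le
  have hlim : Filter.Tendsto (fun m => ∫ X in D',
      ∑ i, ∑ j, |f (Matrix.of X) i j - g m (Matrix.of X) i j| ^ p) Filter.atTop
      (nhds (∫ X in D', ∑ i, ∑ j, |f' X i j - F X i j| ^ p)) := by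
    refine tendsto_integral_of_dominated_convergence (fun _ => n * d * C ^ p)
      (fun m => (hcont m).aestronglyMeasurable hD'.measurableSet)
      (integrableOn_const hD'.measure_lt_top.ne) (fun m => ?_) ?_
    · filter_upwards [ae_restrict_mem hD'.measurableSet] with X hX
      rw [Real.norm_of_nonneg (by positivity)]
      exact sum_abs_rpow_le (M := Matrix.of fun i j => _) hp0.le (hC X hX m)
    · filter_upwards [ae_restrict_mem hD'.measurableSet] with X hX
      refine tendsto_const_nhds.congr' ?_
      filter_upwards [hgF X hX] with m hm
      rw [hm]
      rfl
  have hlt : ∫ X in D', ∑ i, ∑ j, |f' X i j - F X i j| ^ p < ε ^ p := by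
    have h1 : ‖∫ X in D', ∑ i, ∑ j, |f' X i j - F X i j| ^ p‖ ≤
        n * d * ε' ^ p * volume.real D' := by
      refine norm_setIntegral_le_of_norm_le_const hD'.measure_lt_top fun X hX => ?_
      rw [Real.norm_of_nonneg (by positivity)]
      exact sum_abs_rpow_le (M := Matrix.of fun i j => _) hp0.le (hF X hX)
    calc _ ≤ n * d * ε' ^ p * volume.real D' := (le_abs_self _).trans h1
      _ = ε ^ p / (V + 1) * V := by rw [hε'p]; ring
      _ < ε ^ p := by
        rw [div_mul_eq_mul_div, div_lt_iff₀ (by positivity)]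
        have : 0 < ε ^ p := by positivity
        linarith
  obtain ⟨m, hm⟩ := (hlim.eventually_lt_const hlt).exists
  refine ⟨g m, (hg m).1, (hcont m).integrableOn_compact hD', ?_⟩
  calc _ < (ε ^ p) ^ (1 / p) := Real.rpow_lt_rpow (integral_nonneg fun X => by positivity) hm
        (by positivity)
    _ = ε := by rw [one_div, Real.rpow_rpow_inv hε.le hp0.ne']
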